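/- Let $G$ be a second countable locally compact Hausdorff groupoid with unit space $G^0$, range and source maps $r,s$ (the product $xy$ being defined iff $s(x)=r(y)$), and fibres $G^u=r^{-1}(\{u\})$, and let $\{\lambda^u\}_{u\in G^0}$ be a left Haar system on $G$, with $\lambda^u$ a measure on $G^u$. For $f,g\in C_c(G)$ (complex-valued functions) put $\|f\|_{I,r}=\sup_{u\in G^0}\int_{G^u}|f|\,d\lambda^u$ and $(f*g)(x)=\int f(t)\,g(t^{-1}x)\,d\lambda^{r(x)}(t)$, so that $f*g\in C_c(G)$. Let $E^2$ be the Banach space of those continuous sections $\xi$ of the bundle $\{L^2(G^u,\lambda^u)\}_{u\in G^0}$ that vanish at infinity on $G^0$, with norm $\|\xi\|=\sup_{u}\|\xi(u)\|_2$; here a section is continuous if locally on $G^0$ it is a uniform limit of sections $u\mapsto f|_{G^u}$ with $f\in C_c(G)$, that is, for every $u_0\in G^0$ and $\varepsilon>0$ there is $f\in C_c(G)$ with $\|\xi(u)-f|_{G^u}\|_2<\varepsilon$ for all $u$ in some neighbourhood of $u_0$. Regard $C_c(G)\subset E^2$ via $f\mapsto (u\mapsto f|_{G^u})$. Every $F\in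 C_c(G)$ defines a unique bounded linear operator $L_F$ on $E^2$ with $L_Ff=F*f$ for all $f\in C_c(G)$. **Proposition 11.** There is a sequence $\{F_n\}$ in $C_c(G)$ with $F_n\ge 0$ for all $n$ that is a bounded left approximate identity for $C_c(G)$ with respect to $\|\cdot\|_{I,r}$, i.e. $\sup_n\|F_n\|_{I,r}<\infty$ and $\|F_n*f-f\|_{I,r}\to 0$ for every $f\in C_c(G)$, and such that $L_{F_n}\to I$ in the strong operator topology on the bounded operators of $E^2$, i.e. $\|L_{F_n}\xi-\xi\|\to 0$ for every $\xi\in E^2$. -/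

import Mathlib

set_option linter.unusedSectionVars false

open MeasureTheory Filter Topology
open scoped ComplexOrder ENNReal CompactlySupported

/-- A topological groupoid with space of arrows `G` and unit space `X`.  The product `mul x y` is
meaningful only if `s x = r y`: its values at other pairs are arbitrary and never used.
The map `unit` identifies `X` with the space of units inside `G`; it is continuous with continuous
left inverse `r`, so `X` carries the subspace topology. -/
structure TopGroupoid (G X : Type*) [TopologicalSpace G] [TopologicalSpace X] where
  r : G → X
  s : G → X
  unit : X → G
  inv : G → G
  mul : G → G → G
  r_unit : ∀ u, r (unit u) = u
  s_unit : ∀ u, s (unit u) = u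
  r_inv : ∀ x, r (inv x) = s x
  s_inv : ∀ x, s (inv x) = r x
  r_mul : ∀ x y, s x = r y → r (mul x y) = r x
  s_mul : ∀ x y, s x = r y → s (mul x y) = s y
  mul_assoc : ∀ x y z, s x = r y → s y = r z → mul (mul x y) z = mul x (mul y z)
  unit_mul : ∀ x, mul (unit (r x)) x = x
  mul_unit : ∀ x, mul x (unit (s x)) = x
  inv_mul : ∀ x, mul (inv x) x = unit (s x)
  mul_inv : ∀ x, mul x (inv x) = unit (r x)
  continuous_r : Continuous r
  continuous_s : Continuous s
  continuous_unit : Continuous unit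
  continuous_inv : Continuous inv
  continuousOn_mul : ContinuousOn (fun p : G × G => mul p.1 p.2) {p | s p.1 = r p.2}

namespace TopGroupoid

variable {G X : Type*} [TopologicalSpace G] [TopologicalSpace X]

/-- The fibre `G^u = r⁻¹(u)`. -/
abbrev fiber (𝒢 : TopGroupoid G X) (u : X) : Set G := {t | 𝒢.r t = u}

/-- Left translation `t ↦ x t` from `G^{s(x)}` to `G^{r(x)}`. -/
def translate (𝒢 : TopGroupoid G X) (x : G) (t : 𝒢.fiber (𝒢.s x)) : 𝒢.fiber (𝒢.r x) :=
  ⟨𝒢.mul x t, 𝒢.r_mul x t t.2.symm⟩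

end TopGroupoid

/-- A left Haar system: Radon measures `λ^u` on the fibres `G^u`, of full support, left invariant,
and such that `u ↦ ∫ f dλ^u` is continuous for `f ∈ C_c(G)`.  (On a second countable locally
compact Hausdorff space a Radon measure is a Borel measure that is finite on compact sets.) -/
structure HaarSystem {G X : Type*} [TopologicalSpace G] [TopologicalSpace X] [MeasurableSpace G]
    (𝒢 : TopGroupoid G X) where
  meas : ∀ u : X, Measure (𝒢.fiber u)
  finite_on_compacts : ∀ u, IsFiniteMeasureOnCompacts (meas u)
  open_pos : ∀ u, (meas u).IsOpenPosMeasure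
  map_translate : ∀ x : G, (meas (𝒢.s x)).map (𝒢.translate x) = meas (𝒢.r x)
  continuous_integral : ∀ f : C_c(G, ℂ), Continuous fun u => ∫ t, f t ∂(meas u)

attribute [instance] HaarSystem.finite_on_compacts HaarSystem.open_pos

namespace HaarSystem

variable {G X : Type*} [TopologicalSpace G] [TopologicalSpace X] [T2Space G]
  [LocallyCompactSpace G] [SecondCountableTopology G] [MeasurableSpace G] [BorelSpace G]
  {𝒢 : TopGroupoid G X}

/-- `‖f‖_{I,r} = sup_u ∫ |f| dλ^u`. -/
noncomputable def normIr (lam : HaarSystem 𝒢) (f : C_c(G, ℂ)) : ℝ :=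
  ⨆ u : X, ∫ t, ‖f t‖ ∂(lam.meas u)

/-- The convolution `(f * g)(x) = ∫ f(t) g(t⁻¹ x) dλ^{r(x)}(t)` as a function on `G`. -/
noncomputable def convFun (lam : HaarSystem 𝒢) (f g : G → ℂ) (x : G) : ℂ :=
  ∫ t : 𝒢.fiber (𝒢.r x), f t * g (𝒢.mul (𝒢.inv t) x) ∂(lam.meas (𝒢.r x))

theorem t2_units (𝒢 : TopGroupoid G X) : T2Space X :=
  T2Space.of_injective_continuous
    (Function.LeftInverse.injective (g := 𝒢.r) 𝒢.r_unit) 𝒢.continuous_unit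

theorem isClosed_fiber (𝒢 : TopGroupoid G X) (u : X) : IsClosed (𝒢.fiber u) := by
  have := t2_units 𝒢
  exact isClosed_eq 𝒢.continuous_r continuous_const

theorem hasCompactSupport_restrict (f : C_c(G, ℂ)) (u : X) :
    HasCompactSupport (fun t : 𝒢.fiber u => f t) :=
  f.hasCompactSupport.comp_isClosedEmbedding (isClosed_fiber 𝒢 u).isClosedEmbedding_subtypeVal

theorem continuous_restrict (f : C_c(G, ℂ)) (u : X) :
    Continuous (fun t : 𝒢.fiber u => f t) :=
  f.continuous.comp continuous_subtype_val

theorem integrable_restrict (lam : HaarSystem 𝒢) (f : C_c(G, ℂ)) (u : X) :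
    Integrable (fun t : 𝒢.fiber u => f t) (lam.meas u) :=
  (continuous_restrict f u).integrable_of_hasCompactSupport (hasCompactSupport_restrict f u)

theorem memLp_restrict (lam : HaarSystem 𝒢) (f : C_c(G, ℂ)) (u : X) :
    MemLp (fun t : 𝒢.fiber u => f t) 2 (lam.meas u) :=
  (continuous_restrict f u).memLp_of_hasCompactSupport (hasCompactSupport_restrict f u)

/-- A bump function equal to `1` on a compact set. -/
theorem exists_bump {K : Set G} (hK : IsCompact K) :
    ∃ ψ : C_c(G, ℂ), ∃ ρ : G → ℝ, (∀ x, ψ x = ρ x) ∧ (∀ x, 0 ≤ ρ x) ∧ ∀ x ∈ K, ρ x = 1 := by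
  obtain ⟨ρ, h1, -, hc, hI⟩ := exists_continuous_one_zero_of_isCompact hK isClosed_empty
    (Set.disjoint_empty K)
  refine ⟨⟨⟨fun x => (ρ x : ℂ), by fun_prop⟩, ?_⟩, ρ, fun x => rfl, fun x => (hI x).1, h1⟩
  exact hc.comp_left (g := fun y : ℝ => (y : ℂ)) (by simp)

theorem hasCompactSupport_convFun (lam : HaarSystem 𝒢) (f g : C_c(G, ℂ)) :
    HasCompactSupport (lam.convFun f g) := by
  have := t2_units 𝒢
  have hC : IsClosed {p : G × G | 𝒢.s p.1 = 𝒢.r p.2} :=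
    isClosed_eq (𝒢.continuous_s.comp continuous_fst) (𝒢.continuous_r.comp continuous_snd)
  have hK := ((f.hasCompactSupport.isCompact.prod g.hasCompactSupport.isCompact).inter_right
    hC).image_of_continuousOn (𝒢.continuousOn_mul.mono Set.inter_subset_right)
  refine HasCompactSupport.intro hK fun x hx => ?_
  refine integral_eq_zero_of_ae (Eventually.of_forall fun t => ?_)
  by_contra hne
  have ht : 𝒢.r t = 𝒢.r x := t.2
  have h0 := mul_ne_zero_iff.1 hne
  refine hx ⟨(t, 𝒢.mul (𝒢.inv t) x), ⟨⟨subset_tsupport _ h0.1, subset_tsupport _ h0.2⟩, ?_⟩, ?_⟩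
  · show 𝒢.s t = 𝒢.r (𝒢.mul (𝒢.inv t) x)
    rw [𝒢.r_mul _ _ (by rw [𝒢.s_inv, ht]), 𝒢.r_inv]
  · show 𝒢.mul t (𝒢.mul (𝒢.inv t) x) = x
    rw [← 𝒢.mul_assoc _ _ _ (𝒢.r_inv _).symm (by rw [𝒢.s_inv, ht]), 𝒢.mul_inv, ht, 𝒢.unit_mul]

theorem continuousOn_translate (𝒢 : TopGroupoid G X) :
    ContinuousOn (fun p : G × G => 𝒢.mul (𝒢.inv p.1) p.2) {p | 𝒢.r p.1 = 𝒢.r p.2} := by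
  refine 𝒢.continuousOn_mul.comp (f := fun p : G × G => (𝒢.inv p.1, p.2))
    (((𝒢.continuous_inv.comp continuous_fst).prodMk continuous_snd).continuousOn) ?_
  intro p hp
  show 𝒢.s (𝒢.inv p.1) = 𝒢.r p.2
  rw [𝒢.s_inv]; exact hp

theorem continuous_convFun (lam : HaarSystem 𝒢) (f g : C_c(G, ℂ)) :
    Continuous (lam.convFun f g) := by
  have := t2_units 𝒢
  have hcomp := continuousOn_translate 𝒢
  have hslice : ∀ x : G, Continuous fun t : 𝒢.fiber (𝒢.r x) => 𝒢.mul (𝒢.inv t) x := fun x =>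
    hcomp.comp_continuous (continuous_subtype_val.prodMk continuous_const) fun t => t.2
  refine continuous_iff_continuousAt.2 fun x₀ => ?_
  obtain ⟨k, hk⟩ := ContinuousMap.exists_restrict_eq (isClosed_fiber 𝒢 (𝒢.r x₀))
    (⟨fun t => g (𝒢.mul (𝒢.inv t) x₀), g.continuous.comp (hslice x₀)⟩ : C(𝒢.fiber (𝒢.r x₀), ℂ))
  have hk' : ∀ t, 𝒢.r t = 𝒢.r x₀ → k t = g (𝒢.mul (𝒢.inv t) x₀) := fun t ht =>
    congrArg (fun F : C(𝒢.fiber (𝒢.r x₀), ℂ) => F ⟨t, ht⟩) hk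
  let h : C_c(G, ℂ) := ⟨⟨fun t => f t * k t, by fun_prop⟩, f.hasCompactSupport.mul_right⟩
  have hh : ∀ t, h t = f t * k t := fun t => rfl
  obtain ⟨ψ, ρ, hψ, hρ0, hρ1⟩ := exists_bump f.hasCompactSupport.isCompact
  have hψint : ∀ u, Integrable (fun t : 𝒢.fiber u => ρ t) (lam.meas u) := fun u => by
    have := (integrable_restrict lam ψ u).re
    simpa [hψ] using this
  have hψcont : Continuous fun u => ∫ t, ρ t ∂(lam.meas u) := by
    have := Complex.continuous_re.comp (lam.continuous_integral ψ)
    refine this.congr fun u => ?_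
    simp only [Function.comp_apply, hψ]
    rw [show ∫ t : 𝒢.fiber u, (ρ t : ℂ) ∂(lam.meas u) =
      ((∫ t : 𝒢.fiber u, ρ t ∂(lam.meas u) : ℝ) : ℂ) from integral_ofReal]
    exact Complex.ofReal_re _
  set M : ℝ := ∫ t, ρ t ∂(lam.meas (𝒢.r x₀)) with hM
  have hM0 : 0 ≤ M := integral_nonneg fun t => hρ0 t
  have hlim : Tendsto (fun x => ∫ t, h t ∂(lam.meas (𝒢.r x))) (𝓝 x₀)
      (𝓝 (lam.convFun f g x₀)) := by
    have h1 := ((lam.continuous_integral h).comp 𝒢.continuous_r).tendsto x₀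
    have h2 : lam.convFun f g x₀ = ∫ t, h t ∂(lam.meas (𝒢.r x₀)) :=
      integral_congr_ae (Eventually.of_forall fun t => by
        show f t * g _ = h t
        rw [hh, hk' t t.2])
    rw [h2]; exact h1
  have hdiff : Tendsto (fun x => lam.convFun f g x - ∫ t, h t ∂(lam.meas (𝒢.r x))) (𝓝 x₀)
      (𝓝 0) := by
    rw [Metric.tendsto_nhds]
    intro ε hε
    have hδ : 0 < ε / (M + 2) := by positivity
    have hev : ∀ᶠ x in 𝓝 x₀, ∀ t ∈ tsupport f, 𝒢.r t = 𝒢.r x →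
        ‖f t * g (𝒢.mul (𝒢.inv t) x) - h t‖ < ε / (M + 2) := by
      refine f.hasCompactSupport.isCompact.eventually_forall_of_forall_eventually fun t _ => ?_
      by_cases htx : 𝒢.r t = 𝒢.r x₀
      · have hD : ContinuousOn (fun p : G × G =>
            ‖f p.1 * g (𝒢.mul (𝒢.inv p.1) p.2) - h p.1‖) {p | 𝒢.r p.1 = 𝒢.r p.2} :=
          (((f.continuous.comp continuous_fst).continuousOn.mul
            (g.continuous.comp_continuousOn hcomp)).sub
            (h.continuous.comp continuous_fst).continuousOn).norm
        have hlt := (hD (t, x₀) htx).eventually_lt (g := fun _ => ε / (M + 2))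
          continuousWithinAt_const (by
            show ‖f t * g (𝒢.mul (𝒢.inv t) x₀) - h t‖ < _
            rw [hh, hk' t htx, sub_self, norm_zero]; exact hδ)
        have hev := eventually_nhdsWithin_iff.1 hlt
        exact (continuous_swap.tendsto (x₀, t)).eventually hev
      · have : IsOpen {p : G × G | 𝒢.r p.2 ≠ 𝒢.r p.1} :=
          isOpen_ne_fun (𝒢.continuous_r.comp continuous_snd) (𝒢.continuous_r.comp continuous_fst)
        filter_upwards [this.mem_nhds (show 𝒢.r t ≠ 𝒢.r x₀ from htx)] with p hp hp'
        exact absurd hp' hp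
    have hρev : ∀ᶠ x in 𝓝 x₀, ∫ t, ρ t ∂(lam.meas (𝒢.r x)) < M + 1 :=
      ((hψcont.comp 𝒢.continuous_r).tendsto x₀).eventually (gt_mem_nhds (by simp [hM]))
    filter_upwards [hev, hρev] with x hx hx2
    rw [dist_zero_right]
    have hint : Integrable (fun t : 𝒢.fiber (𝒢.r x) => f t * g (𝒢.mul (𝒢.inv t) x))
        (lam.meas (𝒢.r x)) :=
      ((continuous_restrict f _).mul (g.continuous.comp (hslice x))).integrable_of_hasCompactSupport
        (hasCompactSupport_restrict f _).mul_right
    have hle : ∀ t : 𝒢.fiber (𝒢.r x),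
        ‖f t * g (𝒢.mul (𝒢.inv t) x) - h t‖ ≤ ε / (M + 2) * ρ t := by
      intro t
      by_cases ht : (t : G) ∈ tsupport f
      · rw [hρ1 t ht, mul_one]; exact (hx t ht t.2).le
      · rw [hh, image_eq_zero_of_notMem_tsupport ht, zero_mul, zero_mul, sub_zero, norm_zero]
        exact mul_nonneg hδ.le (hρ0 t)
    calc ‖lam.convFun f g x - ∫ t, h t ∂(lam.meas (𝒢.r x))‖
        = ‖∫ t : 𝒢.fiber (𝒢.r x), (f t * g (𝒢.mul (𝒢.inv t) x) - h t) ∂(lam.meas (𝒢.r x))‖ := by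
          rw [integral_sub hint (integrable_restrict lam h _)]; rfl
      _ ≤ ∫ t : 𝒢.fiber (𝒢.r x), ε / (M + 2) * ρ t ∂(lam.meas (𝒢.r x)) :=
          norm_integral_le_of_norm_le ((hψint _).const_mul _) (Eventually.of_forall hle)
      _ = ε / (M + 2) * ∫ t : 𝒢.fiber (𝒢.r x), ρ t ∂(lam.meas (𝒢.r x)) := integral_const_mul _ _
      _ ≤ ε / (M + 2) * (M + 1) := by gcongr
      _ < ε := by
          rw [div_mul_eq_mul_div, div_lt_iff₀ (by positivity)]
          nlinarith
  have := hdiff.add hlim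
  simp only [sub_add_cancel, zero_add] at this
  exact this

/-- The convolution product on `C_c(G)`. -/
noncomputable def conv (lam : HaarSystem 𝒢) (f g : C_c(G, ℂ)) : C_c(G, ℂ) :=
  ⟨⟨lam.convFun f g, lam.continuous_convFun f g⟩, lam.hasCompactSupport_convFun f g⟩

/-- The element `f^u = f|_{G^u}` of `L²(G^u)`, for `f ∈ C_c(G)`. -/
noncomputable def toL2 (lam : HaarSystem 𝒢) (f : C_c(G, ℂ)) (u : X) : Lp ℂ 2 (lam.meas u) :=
  (memLp_restrict lam f u).toLp

/-- Continuity of a section of the left regular bundle `{L²(G^u)}`: near each point of the unit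
space it is uniformly approximated by sections coming from `C_c(G)`. -/
def IsContinuousSection (lam : HaarSystem 𝒢) (ξ : ∀ u : X, Lp ℂ 2 (lam.meas u)) : Prop :=
  ∀ u₀ : X, ∀ ε > 0, ∃ f : C_c(G, ℂ), ∀ᶠ u in 𝓝 u₀, ‖ξ u - lam.toL2 f u‖ < ε

theorem toL2_add (lam : HaarSystem 𝒢) (f g : C_c(G, ℂ)) (u : X) :
    lam.toL2 (f + g) u = lam.toL2 f u + lam.toL2 g u := rfl

theorem toL2_smul (lam : HaarSystem 𝒢) (c : ℂ) (f : C_c(G, ℂ)) (u : X) :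
    lam.toL2 (c • f) u = c • lam.toL2 f u := rfl

theorem toL2_zero (lam : HaarSystem 𝒢) (u : X) : lam.toL2 (0 : C_c(G, ℂ)) u = 0 := rfl

/-- `E²`: the continuous sections of `{L²(G^u)}` vanishing at infinity on the unit space, inside
the Banach space of bounded sections with the norm `‖ξ‖ = sup_u ‖ξ(u)‖`. -/
noncomputable def E2 (lam : HaarSystem 𝒢) :
    Submodule ℂ (lp (fun u : X => Lp ℂ 2 (lam.meas u)) ∞) where
  carrier := {ξ | lam.IsContinuousSection (fun u => ξ u) ∧
    Tendsto (fun u => ‖ξ u‖) (cocompact X) (𝓝 0)}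
  add_mem' := by
    rintro ξ η ⟨h1, h2⟩ ⟨h3, h4⟩
    refine ⟨fun u₀ ε hε => ?_, ?_⟩
    · obtain ⟨f, hf⟩ := h1 u₀ (ε / 2) (half_pos hε)
      obtain ⟨g, hg⟩ := h3 u₀ (ε / 2) (half_pos hε)
      refine ⟨f + g, ?_⟩
      filter_upwards [hf, hg] with u hu hv
      rw [toL2_add]
      calc ‖(ξ + η : lp (fun u : X => Lp ℂ 2 (lam.meas u)) ∞) u - (lam.toL2 f u + lam.toL2 g u)‖
          = ‖(ξ u - lam.toL2 f u) + (η u - lam.toL2 g u)‖ := by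
            rw [lp.coeFn_add, Pi.add_apply]; congr 1; abel
        _ ≤ _ := norm_add_le _ _
        _ < ε := by linarith
    · refine squeeze_zero (fun u => norm_nonneg _) (fun u => ?_) (by simpa using h2.add h4)
      exact norm_add_le _ _
  zero_mem' := by
    refine ⟨fun u₀ ε hε => ⟨0, Eventually.of_forall fun u => ?_⟩, ?_⟩
    · rw [toL2_zero]; simpa using hε
    · simpa using tendsto_const_nhds
  smul_mem' := by
    rintro c ξ ⟨h1, h2⟩
    refine ⟨fun u₀ ε hε => ?_, ?_⟩
    · obtain ⟨f, hf⟩ := h1 u₀ (ε / (‖c‖ + 1)) (by positivity)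
      refine ⟨c • f, ?_⟩
      filter_upwards [hf] with u hu
      rw [toL2_smul, lp.coeFn_smul, Pi.smul_apply, ← smul_sub, norm_smul]
      rw [lt_div_iff₀ (by positivity)] at hu
      nlinarith [norm_nonneg (ξ u - lam.toL2 f u), norm_nonneg c]
    · refine (by simpa using h2.const_mul ‖c‖ :
        Tendsto (fun u => ‖c‖ * ‖ξ u‖) (cocompact X) (𝓝 0)).congr fun u => ?_
      rw [lp.coeFn_smul, Pi.smul_apply, norm_smul]

theorem norm_toL2_sq (lam : HaarSystem 𝒢) (f : C_c(G, ℂ)) (u : X) :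
    ‖lam.toL2 f u‖ ^ 2 = ∫ t, ‖f t‖ ^ 2 ∂(lam.meas u) := by
  have h1 := inner_self_eq_norm_sq_to_K (𝕜 := ℂ) (lam.toL2 f u)
  have h2 : inner ℂ (lam.toL2 f u) (lam.toL2 f u) =
      ((∫ t, ‖f t‖ ^ 2 ∂(lam.meas u) : ℝ) : ℂ) := by
    rw [L2.inner_def, show ((∫ t : 𝒢.fiber u, ‖f t‖ ^ 2 ∂(lam.meas u) : ℝ) : ℂ) =
      ∫ t : 𝒢.fiber u, ((‖f t‖ ^ 2 : ℝ) : ℂ) ∂(lam.meas u) from integral_ofReal.symm]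
    refine integral_congr_ae ?_
    filter_upwards [(memLp_restrict lam f u).coeFn_toLp] with t ht
    rw [toL2, ht, inner_self_eq_norm_sq_to_K]
    simp
  rw [h1] at h2
  exact Complex.ofReal_injective (by rw [← h2]; push_cast; rfl)

theorem toL2_eq_zero (lam : HaarSystem 𝒢) (f : C_c(G, ℂ)) {u : X}
    (hu : u ∉ 𝒢.r '' tsupport f) : lam.toL2 f u = 0 := by
  have : ∀ t : 𝒢.fiber u, f t = 0 := fun t =>
    image_eq_zero_of_notMem_tsupport fun h => hu ⟨t, h, t.2⟩
  rw [toL2, Lp.eq_zero_iff_ae_eq_zero]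
  filter_upwards [(memLp_restrict lam f u).coeFn_toLp] with t ht
  rw [ht, this]; rfl

/-- The supremum defining `‖f‖_{I,r}` is finite. -/
theorem bddAbove_normIr (lam : HaarSystem 𝒢) (f : C_c(G, ℂ)) :
    BddAbove (Set.range fun u : X => ∫ t, ‖f t‖ ∂(lam.meas u)) := by
  let h : C_c(G, ℂ) := ⟨⟨fun t => ((‖f t‖ : ℝ) : ℂ), by fun_prop⟩,
    f.hasCompactSupport.comp_left (g := fun z : ℂ => ((‖z‖ : ℝ) : ℂ)) (by simp)⟩
  have hK : IsCompact (𝒢.r '' tsupport f) :=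
    f.hasCompactSupport.isCompact.image 𝒢.continuous_r
  obtain ⟨C, hC⟩ := hK.exists_bound_of_continuousOn (lam.continuous_integral h).continuousOn
  refine ⟨max C 0, ?_⟩
  rintro _ ⟨u, rfl⟩
  show ∫ t, ‖f t‖ ∂(lam.meas u) ≤ _
  by_cases hu : u ∈ 𝒢.r '' tsupport f
  · refine le_max_of_le_left ((le_of_eq ?_).trans (hC u hu))
    have : ∫ t, h t ∂(lam.meas u) = ((∫ t, ‖f t‖ ∂(lam.meas u) : ℝ) : ℂ) := integral_ofReal
    rw [this, Complex.norm_real, Real.norm_of_nonneg (integral_nonneg fun t => norm_nonneg _)]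
  · refine le_max_of_le_right (le_of_eq (integral_eq_zero_of_ae (Eventually.of_forall fun t => ?_)))
    have : f t = 0 := image_eq_zero_of_notMem_tsupport fun h => hu ⟨t, h, t.2⟩
    show ‖f t‖ = 0
    rw [this, norm_zero]

theorem memlp_toL2 (lam : HaarSystem 𝒢) (f : C_c(G, ℂ)) : Memℓp (lam.toL2 f) ∞ := by
  let h : C_c(G, ℂ) := ⟨⟨fun t => ((‖f t‖ ^ 2 : ℝ) : ℂ), by fun_prop⟩,
    f.hasCompactSupport.comp_left (g := fun z : ℂ => ((‖z‖ ^ 2 : ℝ) : ℂ)) (by simp)⟩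
  have hK : IsCompact (𝒢.r '' tsupport f) :=
    f.hasCompactSupport.isCompact.image 𝒢.continuous_r
  obtain ⟨C, hC⟩ := hK.exists_bound_of_continuousOn (lam.continuous_integral h).continuousOn
  refine memℓp_infty ⟨Real.sqrt (max C 0), ?_⟩
  rintro _ ⟨u, rfl⟩
  refine Real.le_sqrt_of_sq_le ?_
  show ‖lam.toL2 f u‖ ^ 2 ≤ _
  by_cases hu : u ∈ 𝒢.r '' tsupport f
  · refine le_max_of_le_left ((le_of_eq ?_).trans (hC u hu))
    have : ∫ t, h t ∂(lam.meas u) = ((∫ t, ‖f t‖ ^ 2 ∂(lam.meas u) : ℝ) : ℂ) := integral_ofReal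
    rw [this, ← norm_toL2_sq, Complex.norm_real, Real.norm_of_nonneg (by positivity)]
  · rw [toL2_eq_zero lam f hu]; simp

/-- The inclusion of `C_c(G)` in `E²`. -/
noncomputable def toE2 (lam : HaarSystem 𝒢) (f : C_c(G, ℂ)) : lam.E2 :=
  ⟨⟨lam.toL2 f, memlp_toL2 lam f⟩, fun u₀ ε hε => ⟨f, Eventually.of_forall fun u => by
      show ‖lam.toL2 f u - lam.toL2 f u‖ < ε
      rw [sub_self, norm_zero]; exact hε⟩, by
    refine tendsto_const_nhds.congr' ?_
    filter_upwards [(f.hasCompactSupport.isCompact.image 𝒢.continuous_r).compl_mem_cocompact]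
      with u hu
    show 0 = ‖lam.toL2 f u‖
    rw [toL2_eq_zero lam f hu, norm_zero]⟩

/-- `T` is the operator `L_F`: a bounded operator on `E²` extending left convolution by `F`. -/
def IsLeftConv (lam : HaarSystem 𝒢) (F : C_c(G, ℂ)) (T : lam.E2 →L[ℂ] lam.E2) : Prop :=
  ∀ f : C_c(G, ℂ), T (lam.toE2 f) = lam.toE2 (lam.conv F f)

end HaarSystem

namespace HaarSystem

variable {G X : Type*} [TopologicalSpace G] [TopologicalSpace X] [T2Space G]
  [LocallyCompactSpace G] [SecondCountableTopology G] [MeasurableSpace G] [BorelSpace G]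
  {𝒢 : TopGroupoid G X}

/-! Take `F n` to be a nonnegative bump supported in a neighbourhood `W n` of the units, with fibre
integrals at most 1 everywhere and equal to 1 over `r` of the `n`-th compact set of an exhaustion.
Once the exhaustion has swallowed the support of `f`, `(F n * f - f)(x)` is the integral of `F n (t)
(f (t⁻¹ x) - f x)`. As the `W n` shrink to the units over compact sets, this is at most `δ * |ψ x|`,
with `ψ ∈ C_c(G)` depending only on `f` (`exists_approximate_identity`). A pointwise bound of this
shape gives convergence in `‖·‖_{I,r}` and in `E²` at once.

To pass from `C_c(G)` to all of `E²`, two facts suffice: `C_c(G)` is dense (`denseRange_toE2`), and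
convolution by `F` has norm at most `‖F‖_{I,r}` (`norm_toE2_conv_le`). The operators are then
contractions that converge on a dense subspace, hence strongly. -/

theorem locallyCompactSpace_units (𝒢 : TopGroupoid G X) : LocallyCompactSpace X :=
  (Function.LeftInverse.isClosedEmbedding 𝒢.r_unit 𝒢.continuous_r
    𝒢.continuous_unit).locallyCompactSpace

/-! ### The space `E²` -/

theorem norm_toL2_le_of_le (lam : HaarSystem 𝒢) {f g : C_c(G, ℂ)} {c : ℝ} (u : X)
    (h : ∀ x, 𝒢.r x = u → ‖f x‖ ≤ c * ‖g x‖) : ‖lam.toL2 f u‖ ≤ c * ‖lam.toL2 g u‖ := by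
  refine Lp.norm_le_mul_norm_of_ae_le_mul ?_
  filter_upwards [(memLp_restrict lam f u).coeFn_toLp, (memLp_restrict lam g u).coeFn_toLp]
    with t hf hg
  rw [toL2, toL2, hf, hg]
  exact h t t.2

/-- Both defining conditions survive uniform limits. The resulting completeness is what lets
operators be extended from `C_c(G)`. -/
theorem isClosed_E2 (lam : HaarSystem 𝒢) :
    IsClosed (lam.E2 : Set (lp (fun u : X => Lp ℂ 2 (lam.meas u)) ∞)) := by
  refine isClosed_of_closure_subset fun ξ hξ => ?_
  rw [Metric.mem_closure_iff] at hξ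
  have hpt : ∀ (η : lp (fun u : X => Lp ℂ 2 (lam.meas u)) ∞) (u : X),
      ‖ξ u - η u‖ ≤ dist ξ η := fun η u => by
    rw [dist_eq_norm]
    exact lp.norm_apply_le_norm (by simp) (ξ - η) u
  refine ⟨fun u₀ ε hε => ?_, ?_⟩
  · obtain ⟨η, hη, hd⟩ := hξ (ε / 2) (half_pos hε)
    obtain ⟨f, hf⟩ := hη.1 u₀ (ε / 2) (half_pos hε)
    refine ⟨f, ?_⟩
    filter_upwards [hf] with u hu
    have := norm_sub_le_norm_sub_add_norm_sub (ξ u) (η u) (lam.toL2 f u)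
    linarith [hpt η u]
  · rw [Metric.tendsto_nhds]
    intro ε hε
    obtain ⟨η, hη, hd⟩ := hξ (ε / 2) (half_pos hε)
    filter_upwards [hη.2.eventually (gt_mem_nhds (half_pos hε))] with u hu
    have := norm_le_norm_add_norm_sub' (ξ u) (η u)
    rw [dist_zero_right, norm_norm]
    linarith [hpt η u]

instance completeSpace_E2 (lam : HaarSystem 𝒢) : CompleteSpace lam.E2 :=
  (isClosed_E2 lam).completeSpace_coe

/-- The inclusion of `C_c(G)` in `E²`, as a linear map. -/
noncomputable def toE2Linear (lam : HaarSystem 𝒢) : C_c(G, ℂ) →ₗ[ℂ] lam.E2 where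
  toFun := lam.toE2
  map_add' _ _ := rfl
  map_smul' _ _ := rfl

theorem norm_toL2_le (lam : HaarSystem 𝒢) (f : C_c(G, ℂ)) (u : X) :
    ‖lam.toL2 f u‖ ≤ ‖lam.toE2 f‖ :=
  lp.norm_apply_le_norm (E := fun u : X => Lp ℂ 2 (lam.meas u)) (by simp) (lam.toE2 f).1 u

theorem norm_toE2_le (lam : HaarSystem 𝒢) {f : C_c(G, ℂ)} {C : ℝ} (hC : 0 ≤ C)
    (h : ∀ u, ‖lam.toL2 f u‖ ≤ C) : ‖lam.toE2 f‖ ≤ C :=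
  lp.norm_le_of_forall_le (f := (lam.toE2 f).1) hC h

/-- The product of `f` with the pullback along `r` of a function on the unit space. -/
noncomputable def mulUnits (𝒢 : TopGroupoid G X) (φ : C(X, ℝ)) (f : C_c(G, ℂ)) : C_c(G, ℂ) :=
  ⟨⟨fun x => (φ (𝒢.r x) : ℂ) * f x, (Complex.continuous_ofReal.comp
    (φ.continuous.comp 𝒢.continuous_r)).mul f.continuous⟩, f.hasCompactSupport.mul_left⟩

theorem toL2_mulUnits (lam : HaarSystem 𝒢) (φ : C(X, ℝ)) (f : C_c(G, ℂ)) (u : X) :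
    lam.toL2 (mulUnits 𝒢 φ f) u = (φ u : ℂ) • lam.toL2 f u := by
  refine Lp.ext ?_
  filter_upwards [(memLp_restrict lam f u).coeFn_toLp,
    (memLp_restrict lam (mulUnits 𝒢 φ f) u).coeFn_toLp,
    Lp.coeFn_smul (φ u : ℂ) (lam.toL2 f u)] with t h1 h2 h3
  rw [h3, Pi.smul_apply, toL2, toL2, h1, h2]
  show (φ (𝒢.r t) : ℂ) * f t = _
  rw [show 𝒢.r t = u from t.2, smul_eq_mul]

theorem toL2_sum (lam : HaarSystem 𝒢) {ι : Type*} (s : Finset ι) (f : ι → C_c(G, ℂ)) (u : X) :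
    lam.toL2 (∑ i ∈ s, f i) u = ∑ i ∈ s, lam.toL2 (f i) u :=
  map_sum (⟨⟨fun f => lam.toL2 f u, rfl⟩, fun _ _ => rfl⟩ : C_c(G, ℂ) →+ Lp ℂ 2 (lam.meas u)) f s

/-- Off a compact `K` the section is already small; on `K`, finitely many local approximants are
glued by a partition of unity pulled back along `r`. The glued section stays in `C_c(G)` because the
pullbacks only multiply elements of `C_c(G)`. -/
theorem denseRange_toE2 (lam : HaarSystem 𝒢) : DenseRange lam.toE2 := by
  have := t2_units 𝒢
  have := locallyCompactSpace_units 𝒢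
  intro ξ
  rw [Metric.mem_closure_iff]
  intro ε' hε'
  -- The supremum over the units only yields `≤ ε`, so room is left below `ε'`.
  obtain ⟨ε, hε, hlt⟩ := exists_between hε'
  obtain ⟨hc, hv⟩ := ξ.2
  obtain ⟨K, hK, hKs⟩ := mem_cocompact.1 (hv.eventually (gt_mem_nhds hε))
  choose f hf using fun u₀ => hc u₀ ε hε
  obtain ⟨T, -, hT⟩ := hK.elim_nhds_subcover
    (fun u₀ => interior {u | ‖ξ.1 u - lam.toL2 (f u₀) u‖ < ε})
    fun u₀ _ => interior_mem_nhds.2 (hf u₀)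
  obtain ⟨φ, hφ, -⟩ := PartitionOfUnity.exists_isSubordinate_of_locallyFinite_t2space hK
    (fun u₀ : T => interior {u | ‖ξ.1 u - lam.toL2 (f u₀) u‖ < ε}) (fun _ => isOpen_interior)
    (locallyFinite_of_finite _) (by simpa [Set.iUnion_subtype] using hT)
  refine ⟨_, ⟨∑ i : T, mulUnits 𝒢 (φ i) (f i), rfl⟩, lt_of_le_of_lt ?_ hlt⟩
  rw [dist_eq_norm]
  refine lp.norm_le_of_forall_le
    (f := (ξ - lam.toE2 (∑ i : T, mulUnits 𝒢 (φ i) (f i))).1) hε.le fun u => ?_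
  show ‖ξ.1 u - lam.toL2 (∑ i : T, mulUnits 𝒢 (φ i) (f i)) u‖ ≤ ε
  rw [toL2_sum]
  simp_rw [toL2_mulUnits]
  have hsum : ∑ i, φ i u ≤ 1 := by
    have := φ.sum_le_one u
    rwa [finsum_eq_sum_of_fintype] at this
  have hterm : ∀ i, ‖(φ i u : ℂ) • (ξ.1 u - lam.toL2 (f i) u)‖ ≤ φ i u * ε := fun i => by
    rw [norm_smul, Complex.norm_real, Real.norm_of_nonneg (φ.nonneg i u)]
    by_cases h0 : φ i u = 0
    · simp [h0]
    · have := interior_subset (hφ i (subset_tsupport _ h0))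
      exact mul_le_mul_of_nonneg_left (le_of_lt this) (φ.nonneg i u)
  have hrest : ‖((1 - ∑ i, φ i u : ℝ) : ℂ) • ξ.1 u‖ ≤ (1 - ∑ i, φ i u) * ε := by
    rw [norm_smul, Complex.norm_real, Real.norm_of_nonneg (by linarith)]
    by_cases hu : u ∈ K
    · have := φ.sum_eq_one hu
      rw [finsum_eq_sum_of_fintype] at this
      rw [this, sub_self, zero_mul, zero_mul]
    · exact mul_le_mul_of_nonneg_left (le_of_lt (hKs hu)) (by linarith)
  -- The error is a convex combination of quantities that are at most `ε` wherever their weights are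
  -- nonzero; the leftover weight vanishes on `K`, and off `K` it multiplies a small `ξ u`.
  have hsplit : ξ.1 u - ∑ i : T, (φ i u : ℂ) • lam.toL2 (f i) u =
      ((1 - ∑ i, φ i u : ℝ) : ℂ) • ξ.1 u +
        ∑ i : T, (φ i u : ℂ) • (ξ.1 u - lam.toL2 (f i) u) := by
    simp_rw [smul_sub]
    rw [Finset.sum_sub_distrib, ← Finset.sum_smul]
    push_cast
    rw [sub_smul, one_smul]
    abel
  rw [hsplit]
  calc _ ≤ (1 - ∑ i, φ i u) * ε + ∑ i, φ i u * ε :=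
        (norm_add_le _ _).trans (add_le_add hrest (norm_sum_le_of_le _ fun i _ => hterm i))
    _ = ε := by rw [← Finset.sum_mul]; ring

/-! ### Left convolution operators -/

theorem integral_norm_le_normIr (lam : HaarSystem 𝒢) (f : C_c(G, ℂ)) (u : X) :
    ∫ t, ‖f t‖ ∂(lam.meas u) ≤ lam.normIr f :=
  le_ciSup (bddAbove_normIr lam f) u

theorem normIr_nonneg (lam : HaarSystem 𝒢) (f : C_c(G, ℂ)) : 0 ≤ lam.normIr f :=
  Real.iSup_nonneg fun _ => integral_nonneg fun _ => norm_nonneg _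

/-- Together with `norm_toE2_le_of_le`, this turns a single pointwise estimate into convergence in
either norm. -/
theorem normIr_le_of_le (lam : HaarSystem 𝒢) {f g : C_c(G, ℂ)} {c : ℝ} (hc : 0 ≤ c)
    (h : ∀ x, ‖f x‖ ≤ c * ‖g x‖) : lam.normIr f ≤ c * lam.normIr g := by
  refine Real.iSup_le (fun u => ?_) (mul_nonneg hc (normIr_nonneg lam g))
  calc ∫ t, ‖f t‖ ∂(lam.meas u) ≤ ∫ t, c * ‖g t‖ ∂(lam.meas u) :=
        integral_mono (integrable_restrict lam f u).norm
          ((integrable_restrict lam g u).norm.const_mul c) fun t => h t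
    _ = c * ∫ t, ‖g t‖ ∂(lam.meas u) := integral_const_mul _ _
    _ ≤ _ := mul_le_mul_of_nonneg_left (integral_norm_le_normIr lam g u) hc

theorem norm_toE2_le_of_le (lam : HaarSystem 𝒢) {f g : C_c(G, ℂ)} {c : ℝ} (hc : 0 ≤ c)
    (h : ∀ x, ‖f x‖ ≤ c * ‖g x‖) : ‖lam.toE2 f‖ ≤ c * ‖lam.toE2 g‖ :=
  norm_toE2_le lam (mul_nonneg hc (norm_nonneg _)) fun u =>
    (norm_toL2_le_of_le lam u fun x _ => h x).trans
      (mul_le_mul_of_nonneg_left (norm_toL2_le lam g u) hc)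

theorem enorm_toL2_sq (lam : HaarSystem 𝒢) (f : C_c(G, ℂ)) (u : X) :
    ‖lam.toL2 f u‖ₑ ^ 2 = ∫⁻ t, ‖f t‖ₑ ^ 2 ∂(lam.meas u) := by
  have hint : Integrable (fun t : 𝒢.fiber u => ‖f t‖ ^ 2) (lam.meas u) :=
    (memLp_restrict lam f u).integrable_norm_pow (by simp)
  rw [← ofReal_norm, ← ENNReal.ofReal_pow (norm_nonneg _), norm_toL2_sq,
    ofReal_integral_eq_lintegral_ofReal hint (Eventually.of_forall fun t => by positivity)]
  simp_rw [ENNReal.ofReal_pow (norm_nonneg _), ofReal_norm]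

theorem lintegral_enorm_le_normIr (lam : HaarSystem 𝒢) (f : C_c(G, ℂ)) (u : X) :
    ∫⁻ t, ‖f t‖ₑ ∂(lam.meas u) ≤ ENNReal.ofReal (lam.normIr f) := by
  have := ofReal_integral_eq_lintegral_ofReal (integrable_restrict lam f u).norm
    (Eventually.of_forall fun t => norm_nonneg _)
  simp_rw [ofReal_norm] at this
  rw [← this]
  exact ENNReal.ofReal_le_ofReal (integral_norm_le_normIr lam f u)

theorem continuous_translate (𝒢 : TopGroupoid G X) (x : G) : Continuous (𝒢.translate x) := by
  refine Continuous.subtype_mk ?_ _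
  exact 𝒢.continuousOn_mul.comp_continuous (continuous_const.prodMk continuous_subtype_val)
    fun t => t.2.symm

/-- Left invariance of the Haar system. -/
theorem lintegral_translate (lam : HaarSystem 𝒢) (x : G) {g : G → ℝ≥0∞} (hg : Measurable g)
    {u : X} (hu : 𝒢.s x = u) :
    ∫⁻ t : 𝒢.fiber u, g (𝒢.mul x t) ∂(lam.meas u) = ∫⁻ t, g t ∂(lam.meas (𝒢.r x)) := by
  subst hu
  rw [← lam.map_translate x]
  exact (lintegral_map (f := fun t : 𝒢.fiber (𝒢.r x) => g t) (hg.comp measurable_subtype_coe)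
    (continuous_translate 𝒢 x).measurable).symm

/-- Translation by `t⁻¹` carries the fibre over `r t` onto the fibre over `s t`, preserving the
measures. -/
theorem lintegral_translate_inv (lam : HaarSystem 𝒢) (f : C_c(G, ℂ)) {u : X} (t : 𝒢.fiber u) :
    ∫⁻ x : 𝒢.fiber u, ‖f (𝒢.mul (𝒢.inv t) x)‖ₑ ^ 2 ∂(lam.meas u) =
      ‖lam.toL2 f (𝒢.s t)‖ₑ ^ 2 := by
  have hg : Measurable fun x => ‖f x‖ₑ ^ 2 := (f.continuous.measurable.enorm).pow_const 2
  rw [lintegral_translate lam (𝒢.inv t) hg ((𝒢.s_inv t).trans t.2), 𝒢.r_inv, enorm_toL2_sq]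

/-- A closed fibre is locally compact and second countable, hence σ-compact. Tonelli's theorem needs
this. -/
instance sigmaFinite_meas (lam : HaarSystem 𝒢) (u : X) : SigmaFinite (lam.meas u) := by
  have : LocallyCompactSpace (𝒢.fiber u) := (isClosed_fiber 𝒢 u).locallyCompactSpace
  infer_instance

theorem continuous_mul_inv_fiber (𝒢 : TopGroupoid G X) (u : X) :
    Continuous fun p : 𝒢.fiber u × 𝒢.fiber u => 𝒢.mul (𝒢.inv p.1) p.2 :=
  (continuousOn_translate 𝒢).comp_continuous
    ((continuous_subtype_val.comp continuous_fst).prodMk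
      (continuous_subtype_val.comp continuous_snd)) fun p => p.1.2.trans p.2.2.symm

theorem convFun_apply (lam : HaarSystem 𝒢) (f g : G → ℂ) {u : X} (x : 𝒢.fiber u) :
    lam.convFun f g x = ∫ t : 𝒢.fiber u, f t * g (𝒢.mul (𝒢.inv t) x) ∂(lam.meas u) := by
  obtain ⟨x, rfl⟩ := x
  rfl

/-- Cauchy–Schwarz for the splitting `|F| |f| = |F|^(1/2) · (|F|^(1/2) |f|)`. -/
theorem enorm_convFun_sq_le (lam : HaarSystem 𝒢) (F f : C_c(G, ℂ)) {u : X} (x : 𝒢.fiber u) :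
    ‖lam.convFun F f x‖ₑ ^ 2 ≤ (∫⁻ t, ‖F t‖ₑ ∂(lam.meas u)) *
      ∫⁻ t : 𝒢.fiber u, ‖F t‖ₑ * ‖f (𝒢.mul (𝒢.inv t) x)‖ₑ ^ 2 ∂(lam.meas u) := by
  have hF : Measurable fun t : 𝒢.fiber u => ‖F t‖ₑ :=
    (continuous_restrict F u).measurable.enorm
  have hf : Measurable fun t : 𝒢.fiber u => ‖f (𝒢.mul (𝒢.inv t) x)‖ₑ :=
    (f.continuous.comp ((continuous_mul_inv_fiber 𝒢 u).comp
      (continuous_id.prodMk continuous_const))).measurable.enorm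
  have h := ENNReal.lintegral_mul_norm_pow_le (μ := lam.meas u) hF.aemeasurable
    (hF.mul (hf.pow_const 2)).aemeasurable (p := 1 / 2) (q := 1 / 2) (by norm_num) (by norm_num)
    (by norm_num)
  have hsq : ∀ a : ℝ≥0∞, (a ^ (1 / 2 : ℝ)) ^ 2 = a := fun a => by
    rw [← ENNReal.rpow_natCast, ← ENNReal.rpow_mul]; norm_num
  have hprod : ∀ a b : ℝ≥0∞, a ^ (1 / 2 : ℝ) * (a * b ^ 2) ^ (1 / 2 : ℝ) = a * b := fun a b => by
    rw [ENNReal.mul_rpow_of_nonneg _ _ (by norm_num), ← mul_assoc, ← sq, hsq,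
      ← ENNReal.rpow_natCast, ← ENNReal.rpow_mul]
    norm_num
  simp only [Pi.mul_apply, hprod] at h
  rw [convFun_apply]
  calc _ ≤ (∫⁻ t : 𝒢.fiber u, ‖F t‖ₑ * ‖f (𝒢.mul (𝒢.inv t) x)‖ₑ ∂(lam.meas u)) ^ 2 := by
        gcongr
        refine (enorm_integral_le_lintegral_enorm _).trans (le_of_eq ?_)
        simp_rw [enorm_mul]
    _ ≤ _ := by
        refine (pow_le_pow_left' h 2).trans (le_of_eq ?_)
        rw [mul_pow, hsq, hsq]

/-- A Young inequality: Cauchy–Schwarz, Tonelli, left invariance. Translation moves the `L²` norm of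
`f` from the unit `r t` to `s t`, but the `E²` norm is a supremum over all units and absorbs this,
so the one-sided norm of `F` suffices. -/
theorem norm_toE2_conv_le (lam : HaarSystem 𝒢) (F f : C_c(G, ℂ)) :
    ‖lam.toE2 (lam.conv F f)‖ ≤ lam.normIr F * ‖lam.toE2 f‖ := by
  have h0 := mul_nonneg (normIr_nonneg lam F) (norm_nonneg (lam.toE2 f))
  refine norm_toE2_le lam h0 fun u => ?_
  have hmeas : Measurable fun p : 𝒢.fiber u × 𝒢.fiber u =>
      ‖F p.2‖ₑ * ‖f (𝒢.mul (𝒢.inv p.2) p.1)‖ₑ ^ 2 :=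
    ((continuous_restrict F u).comp continuous_snd).measurable.enorm.mul
      ((f.continuous.comp ((continuous_mul_inv_fiber 𝒢 u).comp
        continuous_swap)).measurable.enorm.pow_const 2)
  have key : ‖lam.toL2 (lam.conv F f) u‖ₑ ^ 2 ≤
      ENNReal.ofReal (lam.normIr F * ‖lam.toE2 f‖) ^ 2 := by
    rw [enorm_toL2_sq]
    calc _ ≤ ∫⁻ x : 𝒢.fiber u, (∫⁻ t, ‖F t‖ₑ ∂(lam.meas u)) *
          (∫⁻ t : 𝒢.fiber u, ‖F t‖ₑ * ‖f (𝒢.mul (𝒢.inv t) x)‖ₑ ^ 2 ∂(lam.meas u))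
            ∂(lam.meas u) := lintegral_mono fun x => enorm_convFun_sq_le lam F f x
      _ = (∫⁻ t, ‖F t‖ₑ ∂(lam.meas u)) * ∫⁻ t : 𝒢.fiber u, ∫⁻ x : 𝒢.fiber u,
            ‖F t‖ₑ * ‖f (𝒢.mul (𝒢.inv t) x)‖ₑ ^ 2 ∂(lam.meas u) ∂(lam.meas u) := by
          rw [lintegral_const_mul _ hmeas.lintegral_prod_right',
            lintegral_lintegral_swap hmeas.aemeasurable]
      _ = (∫⁻ t, ‖F t‖ₑ ∂(lam.meas u)) * ∫⁻ t : 𝒢.fiber u,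
            ‖F t‖ₑ * ‖lam.toL2 f (𝒢.s t)‖ₑ ^ 2 ∂(lam.meas u) := by
          congr 1
          refine lintegral_congr fun t => ?_
          rw [lintegral_const_mul, lintegral_translate_inv]
          exact (f.continuous.comp ((continuous_mul_inv_fiber 𝒢 u).comp
            (continuous_const.prodMk continuous_id))).measurable.enorm.pow_const 2
      _ ≤ (∫⁻ t, ‖F t‖ₑ ∂(lam.meas u)) * ∫⁻ t : 𝒢.fiber u,
            ‖F t‖ₑ * ENNReal.ofReal ‖lam.toE2 f‖ ^ 2 ∂(lam.meas u) := by
          gcongr with t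
          rw [← ofReal_norm]
          exact ENNReal.ofReal_le_ofReal (norm_toL2_le lam f _)
      _ = (∫⁻ t, ‖F t‖ₑ ∂(lam.meas u)) ^ 2 * ENNReal.ofReal ‖lam.toE2 f‖ ^ 2 := by
          rw [lintegral_mul_const _ (continuous_restrict F u).measurable.enorm, ← mul_assoc,
            ← sq]
      _ ≤ _ := by
          rw [ENNReal.ofReal_mul (normIr_nonneg lam F), mul_pow]
          gcongr
          exact lintegral_enorm_le_normIr lam F u
  rw [← ofReal_norm, ← ENNReal.ofReal_pow (norm_nonneg _), ← ENNReal.ofReal_pow h0,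
    ENNReal.ofReal_le_ofReal_iff (by positivity)] at key
  exact le_of_sq_le_sq key h0

theorem integrable_convFun (lam : HaarSystem 𝒢) (F f : C_c(G, ℂ)) {u : X} (x : 𝒢.fiber u) :
    Integrable (fun t : 𝒢.fiber u => F t * f (𝒢.mul (𝒢.inv t) x)) (lam.meas u) :=
  ((continuous_restrict F u).mul (f.continuous.comp ((continuous_mul_inv_fiber 𝒢 u).comp
    (continuous_id.prodMk continuous_const)))).integrable_of_hasCompactSupport
    (hasCompactSupport_restrict F u).mul_right

/-- Left convolution by `F`, as a linear map from `C_c(G)` to `E²`. -/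
noncomputable def convLinear (lam : HaarSystem 𝒢) (F : C_c(G, ℂ)) : C_c(G, ℂ) →ₗ[ℂ] lam.E2 :=
  lam.toE2Linear ∘ₗ
    { toFun := lam.conv F
      map_add' := fun f g => by
        ext x
        show lam.convFun F (f + g : C_c(G, ℂ)) x = lam.convFun F f x + lam.convFun F g x
        have hf := integrable_convFun lam F f (⟨x, rfl⟩ : 𝒢.fiber (𝒢.r x))
        have hg := integrable_convFun lam F g (⟨x, rfl⟩ : 𝒢.fiber (𝒢.r x))
        rw [convFun, convFun, convFun, ← integral_add hf hg]
        simp [mul_add]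
      map_smul' := fun c f => by
        ext x
        show lam.convFun F (c • f : C_c(G, ℂ)) x = c * lam.convFun F f x
        rw [convFun, convFun, ← integral_const_mul]
        simp [mul_left_comm] }

/-- Extension by continuity from a dense subspace; density also forces uniqueness. -/
theorem existsUnique_isLeftConv (lam : HaarSystem 𝒢) (F : C_c(G, ℂ)) :
    ∃! T : lam.E2 →L[ℂ] lam.E2, lam.IsLeftConv F T := by
  refine ⟨(lam.convLinear F).extendOfNorm lam.toE2Linear, fun f => ?_, fun T hT => ?_⟩
  · exact LinearMap.extendOfNorm_eq (f := lam.convLinear F) (e := lam.toE2Linear)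
      (denseRange_toE2 lam) ⟨_, norm_toE2_conv_le lam F⟩ f
  · exact (LinearMap.extendOfNorm_unique (f := lam.convLinear F) (e := lam.toE2Linear)
      (denseRange_toE2 lam) _ (norm_toE2_conv_le lam F) T (LinearMap.ext hT)).symm

theorem IsLeftConv.norm_apply_le {lam : HaarSystem 𝒢} {F : C_c(G, ℂ)}
    {T : lam.E2 →L[ℂ] lam.E2} (hT : lam.IsLeftConv F T) (ξ : lam.E2) :
    ‖T ξ‖ ≤ lam.normIr F * ‖ξ‖ := by
  refine (denseRange_toE2 lam).induction_on ξ
    (isClosed_le (by fun_prop) (by fun_prop)) fun f => ?_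
  rw [hT f]
  exact norm_toE2_conv_le lam F f

end HaarSystem

/-! ### The approximate identity -/

namespace TopGroupoid

variable {G X : Type*} [TopologicalSpace G] [TopologicalSpace X]

theorem inv_unit_mul (𝒢 : TopGroupoid G X) (x : G) :
    𝒢.mul (𝒢.inv (𝒢.unit (𝒢.r x))) x = x := by
  conv_lhs => rw [← 𝒢.unit_mul x, 𝒢.r_mul _ _ (𝒢.s_unit _), 𝒢.r_unit]
  rw [← 𝒢.mul_assoc _ _ _ (by rw [𝒢.s_inv]) (𝒢.s_unit _), 𝒢.inv_mul, 𝒢.s_unit, 𝒢.unit_mul]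

theorem mul_inv_mul (𝒢 : TopGroupoid G X) {t x : G} (h : 𝒢.r x = 𝒢.r t) :
    𝒢.mul t (𝒢.mul (𝒢.inv t) x) = x := by
  rw [← 𝒢.mul_assoc _ _ _ (𝒢.r_inv _).symm (by rw [𝒢.s_inv, h]), 𝒢.mul_inv, ← h, 𝒢.unit_mul]

theorem r_inv_mul (𝒢 : TopGroupoid G X) {t x : G} (h : 𝒢.r x = 𝒢.r t) :
    𝒢.r (𝒢.mul (𝒢.inv t) x) = 𝒢.s t := by
  rw [𝒢.r_mul _ _ (by rw [𝒢.s_inv, h]), 𝒢.r_inv]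

/-- A sequence of neighbourhoods of the unit space shrinking to it over compact sets. -/
theorem exists_seq_nhds_units [T2Space G] [LocallyCompactSpace G] [SecondCountableTopology G]
    (𝒢 : TopGroupoid G X) :
    ∃ W : ℕ → Set G, (∀ n, IsOpen (W n)) ∧ (∀ n u, 𝒢.unit u ∈ W n) ∧
      ∀ K : Set X, IsCompact K → ∀ V : Set G, IsOpen V → (∀ u ∈ K, 𝒢.unit u ∈ V) →
        ∀ᶠ n in atTop, ∀ t ∈ W n, 𝒢.r t ∈ K ∨ 𝒢.s t ∈ K → t ∈ V := by
  let := TopologicalSpace.metrizableSpaceMetric G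
  -- Closeness is imposed at both ends: the first distance is used when `r t ∈ K`, the second when
  -- `s t ∈ K`.
  refine ⟨fun n => {t | dist t (𝒢.unit (𝒢.r t)) < 1 / ((n : ℝ) + 1)} ∩
    {t | dist t (𝒢.unit (𝒢.s t)) < 1 / ((n : ℝ) + 1)}, fun n => ?_, fun n u => ?_,
    fun K hK V hV hKV => ?_⟩
  · exact (isOpen_lt (continuous_id.dist (𝒢.continuous_unit.comp 𝒢.continuous_r))
      continuous_const).inter (isOpen_lt
        (continuous_id.dist (𝒢.continuous_unit.comp 𝒢.continuous_s)) continuous_const)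
  · constructor
    · show dist _ _ < _
      rw [𝒢.r_unit, dist_self]; positivity
    · show dist _ _ < _
      rw [𝒢.s_unit, dist_self]; positivity
  · obtain ⟨δ, hδ, hsub⟩ := (hK.image 𝒢.continuous_unit).exists_thickening_subset_open hV
      (Set.image_subset_iff.2 hKV)
    have hlim := (tendsto_one_div_add_atTop_nhds_zero_nat (𝕜 := ℝ)).eventually (gt_mem_nhds hδ)
    filter_upwards [hlim] with n hn t ht htK
    refine hsub (Metric.mem_thickening_iff.2 ?_)
    rcases htK with h | h
    · exact ⟨_, ⟨_, h, rfl⟩, lt_trans ht.1 hn⟩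
    · exact ⟨_, ⟨_, h, rfl⟩, lt_trans ht.2 hn⟩

end TopGroupoid

namespace HaarSystem

variable {G X : Type*} [TopologicalSpace G] [TopologicalSpace X] [T2Space G]
  [LocallyCompactSpace G] [SecondCountableTopology G] [MeasurableSpace G] [BorelSpace G]
  {𝒢 : TopGroupoid G X}

/-- Uniform continuity of left translation near the units: the difference between `f` and its
translates is dominated by small multiples of a single element of `C_c(G)`. -/
theorem exists_translate_sub_le (𝒢 : TopGroupoid G X) (f : C_c(G, ℂ)) :
    ∃ ψ : C_c(G, ℂ), ∀ δ > 0, ∃ V : Set G, IsOpen V ∧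
      (∀ u ∈ 𝒢.r '' tsupport f, 𝒢.unit u ∈ V) ∧
      ∀ t ∈ V, ∀ x, 𝒢.r x = 𝒢.r t → ‖f (𝒢.mul (𝒢.inv t) x) - f x‖ ≤ δ * ‖ψ x‖ := by
  have := t2_units 𝒢
  have hK : IsCompact (𝒢.r '' tsupport f) :=
    f.hasCompactSupport.isCompact.image 𝒢.continuous_r
  obtain ⟨C, hC, hCK⟩ := exists_compact_superset (hK.image 𝒢.continuous_unit)
  have hD : IsClosed {p : G × G | 𝒢.s p.1 = 𝒢.r p.2} :=
    isClosed_eq (𝒢.continuous_s.comp continuous_fst) (𝒢.continuous_r.comp continuous_snd)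
  have hCf := ((hC.prod f.hasCompactSupport.isCompact).inter_right
    hD).image_of_continuousOn (𝒢.continuousOn_mul.mono Set.inter_subset_right)
  -- `L` contains the support of `f` and of every translate of `f` by `t ∈ C`. It does not depend on
  -- `δ`, so one `ψ` equal to 1 on `L` serves for all `δ`.
  set L : Set G := tsupport f ∪ (fun p : G × G => 𝒢.mul p.1 p.2) ''
    (C ×ˢ tsupport f ∩ {p : G × G | 𝒢.s p.1 = 𝒢.r p.2}) with hL
  have hLc : IsCompact L := f.hasCompactSupport.isCompact.union hCf
  obtain ⟨ψ, ρ, hψ, -, hρ1⟩ := exists_bump hLc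
  refine ⟨ψ, fun δ hδ => ?_⟩
  set S : Set G := {t | ∀ x ∈ L, 𝒢.r x = 𝒢.r t → ‖f (𝒢.mul (𝒢.inv t) x) - f x‖ < δ} with hS
  refine ⟨interior C ∩ interior S, isOpen_interior.inter isOpen_interior, fun u hu =>
    ⟨hCK ⟨u, hu, rfl⟩, mem_interior_iff_mem_nhds.2 ?_⟩, ?_⟩
  · show ∀ᶠ t in 𝓝 (𝒢.unit u), ∀ x ∈ L, 𝒢.r x = 𝒢.r t → ‖f (𝒢.mul (𝒢.inv t) x) - f x‖ < δ
    refine hLc.eventually_forall_of_forall_eventually fun x _ => ?_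
    by_cases hx : 𝒢.r x = u
    · have hcont : ContinuousOn (fun p : G × G => ‖f (𝒢.mul (𝒢.inv p.1) p.2) - f p.2‖)
          {p | 𝒢.r p.1 = 𝒢.r p.2} :=
        ((f.continuous.comp_continuousOn (continuousOn_translate 𝒢)).sub
          (f.continuous.comp continuous_snd).continuousOn).norm
      have hlt := (hcont (𝒢.unit u, x) ((𝒢.r_unit u).trans hx.symm)).eventually_lt
        (g := fun _ => δ) continuousWithinAt_const (by
          show ‖f (𝒢.mul (𝒢.inv (𝒢.unit u)) x) - f x‖ < δ
          rw [← hx, 𝒢.inv_unit_mul, sub_self, norm_zero]; exact hδ)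
      filter_upwards [eventually_nhdsWithin_iff.1 hlt] with p hp hp'
      exact hp hp'.symm
    -- Here the fibre condition fails on a whole neighbourhood, so the claim is vacuous there.
    · have hne : IsOpen {p : G × G | 𝒢.r p.2 ≠ 𝒢.r p.1} :=
        isOpen_ne_fun (𝒢.continuous_r.comp continuous_snd) (𝒢.continuous_r.comp continuous_fst)
      filter_upwards [hne.mem_nhds (show 𝒢.r x ≠ 𝒢.r (𝒢.unit u) by rwa [𝒢.r_unit])] with p hp hp'
      exact absurd hp' hp
  · rintro t ⟨htC, htS⟩ x hx
    by_cases hxL : x ∈ L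
    · rw [hψ, hρ1 x hxL]
      simpa using (interior_subset htS x hxL hx).le
    · have h1 : f x = 0 := image_eq_zero_of_notMem_tsupport fun h => hxL (Or.inl h)
      have h2 : f (𝒢.mul (𝒢.inv t) x) = 0 := image_eq_zero_of_notMem_tsupport fun h =>
        hxL (Or.inr ⟨(t, 𝒢.mul (𝒢.inv t) x), ⟨⟨interior_subset htC, h⟩, (𝒢.r_inv_mul hx).symm⟩,
          𝒢.mul_inv_mul hx⟩)
      rw [h1, h2, sub_zero, norm_zero]
      positivity

theorem continuous_integral_real (lam : HaarSystem 𝒢) {h : G → ℝ} (hc : Continuous h)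
    (hs : HasCompactSupport h) : Continuous fun u => ∫ t, h t ∂(lam.meas u) := by
  let k : C_c(G, ℂ) := ⟨⟨fun t => (h t : ℂ), by fun_prop⟩,
    hs.comp_left (g := fun y : ℝ => (y : ℂ)) (by simp)⟩
  refine (Complex.continuous_re.comp (lam.continuous_integral k)).congr fun u => ?_
  have : ∫ t, k t ∂(lam.meas u) = ((∫ t, h t ∂(lam.meas u) : ℝ) : ℂ) := integral_ofReal
  simp only [Function.comp_apply, this, Complex.ofReal_re]

/-- A nonnegative function supported near the units, with fibre integrals at most `1` everywhere
and equal to `1` over a given compact set. -/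
theorem exists_normalized_bump (lam : HaarSystem 𝒢) {W : Set G} (hW : IsOpen W)
    (hunit : ∀ u, 𝒢.unit u ∈ W) {K : Set X} (hK : IsCompact K) :
    ∃ ρ : G → ℝ, Continuous ρ ∧ HasCompactSupport ρ ∧ (∀ x, 0 ≤ ρ x) ∧
      (∀ x, ρ x ≠ 0 → x ∈ W) ∧ (∀ u, ∫ t, ρ t ∂(lam.meas u) ≤ 1) ∧
      ∀ u ∈ K, ∫ t, ρ t ∂(lam.meas u) = 1 := by
  obtain ⟨h, h1, h0, hs, hI⟩ := exists_continuous_one_zero_of_isCompact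
    (hK.image 𝒢.continuous_unit) hW.isClosed_compl (by
      rw [Set.disjoint_compl_right_iff_subset]
      rintro _ ⟨u, -, rfl⟩
      exact hunit u)
  set H : X → ℝ := fun u => ∫ t, h t ∂(lam.meas u) with hH
  have hHc : Continuous H := continuous_integral_real lam h.continuous hs
  -- Full support of the Haar measures enters here.
  have hHpos : ∀ u ∈ K, 0 < H u := fun u hu => by
    refine Continuous.integral_pos_of_hasCompactSupport_nonneg_nonzero
      (f := fun t : 𝒢.fiber u => h t) (x := ⟨𝒢.unit u, 𝒢.r_unit u⟩)
      (h.continuous.comp continuous_subtype_val)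
      (hs.comp_isClosedEmbedding (isClosed_fiber 𝒢 u).isClosedEmbedding_subtypeVal)
      (fun t => (hI t).1) ?_
    show h (𝒢.unit u) ≠ 0
    rw [h1 ⟨u, hu, rfl⟩]
    exact one_ne_zero
  -- `c` is a positive lower bound of `H` on `K`. Dividing by `max H c` instead of `H` keeps the
  -- quotient continuous everywhere and changes nothing over `K`.
  obtain ⟨c, hc, hcK⟩ := hK.exists_forall_le' hHc.continuousOn hHpos
  have hmax : ∀ u, 0 < max (H u) c := fun u => lt_max_of_lt_right hc
  have hint : ∀ u, ∫ t : 𝒢.fiber u, h t * (max (H (𝒢.r t)) c)⁻¹ ∂(lam.meas u) =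
      H u * (max (H u) c)⁻¹ := fun u => by
    rw [← integral_mul_const]
    refine integral_congr_ae (Eventually.of_forall fun t => ?_)
    show h t * (max (H (𝒢.r t)) c)⁻¹ = _
    rw [show 𝒢.r t = u from t.2]
  refine ⟨fun x => h x * (max (H (𝒢.r x)) c)⁻¹, ?_, hs.mul_right, fun x => ?_, fun x hx => ?_,
    fun u => ?_, fun u hu => ?_⟩
  · exact h.continuous.mul (((hHc.comp 𝒢.continuous_r).max continuous_const).inv₀
      fun x => (hmax _).ne')
  · exact mul_nonneg (hI x).1 (inv_nonneg.2 (hmax _).le)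
  · by_contra hxW
    exact hx (by simp [h0 hxW])
  · rw [hint, ← div_eq_mul_inv, div_le_one (hmax u)]
    exact le_max_left _ _
  · rw [hint, max_eq_left (hcK u hu), mul_inv_cancel₀ (hHpos u hu).ne']

/-- Where `f x ≠ 0` the fibre integral of `F` is 1, so `f x` is the integral of `F t * f x`; where
`f x = 0` this is trivial. The difference is therefore an average of `f (t⁻¹ x) - f x` with total
weight at most 1. -/
theorem norm_conv_sub_le (lam : HaarSystem 𝒢) {F f : C_c(G, ℂ)} {ρ : G → ℝ}
    (hFρ : ∀ x, F x = ρ x) (hρ0 : ∀ x, 0 ≤ ρ x) (hρ1 : ∀ u, ∫ t, ρ t ∂(lam.meas u) ≤ 1) {x : G}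
    (hx1 : f x ≠ 0 → ∫ t, ρ t ∂(lam.meas (𝒢.r x)) = 1) {c : ℝ} (hc : 0 ≤ c)
    (h : ∀ t, ρ t ≠ 0 → 𝒢.r x = 𝒢.r t → ‖f (𝒢.mul (𝒢.inv t) x) - f x‖ ≤ c) :
    ‖(lam.conv F f - f) x‖ ≤ c := by
  have hFint : ∫ t, F t ∂(lam.meas (𝒢.r x)) = ((∫ t, ρ t ∂(lam.meas (𝒢.r x)) : ℝ) : ℂ) := by
    simp_rw [hFρ]
    exact integral_ofReal
  have hfx : f x = ∫ t : 𝒢.fiber (𝒢.r x), F t * f x ∂(lam.meas (𝒢.r x)) := by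
    rw [integral_mul_const, hFint]
    by_cases h0 : f x = 0
    · simp [h0]
    · simp [hx1 h0]
  have hρint : Integrable (fun t : 𝒢.fiber (𝒢.r x) => ρ t) (lam.meas (𝒢.r x)) := by
    simpa [hFρ] using (integrable_restrict lam F (𝒢.r x)).re
  have hsub : (lam.conv F f - f) x = ∫ t : 𝒢.fiber (𝒢.r x),
      F t * (f (𝒢.mul (𝒢.inv t) x) - f x) ∂(lam.meas (𝒢.r x)) := by
    show lam.convFun F f x - f x = _
    simp_rw [mul_sub]
    rw [integral_sub (integrable_convFun lam F f (⟨x, rfl⟩ : 𝒢.fiber (𝒢.r x)))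
      ((integrable_restrict lam F _).mul_const _), ← hfx]
    rfl
  rw [hsub]
  calc _ ≤ ∫ t : 𝒢.fiber (𝒢.r x), ρ t * c ∂(lam.meas (𝒢.r x)) := by
        refine norm_integral_le_of_norm_le (hρint.mul_const c) (Eventually.of_forall fun t => ?_)
        rw [norm_mul, hFρ, Complex.norm_real, Real.norm_of_nonneg (hρ0 t)]
        by_cases ht : ρ t = 0
        · simp [ht]
        · exact mul_le_mul_of_nonneg_left (h t ht t.2.symm) (hρ0 t)
    _ = (∫ t, ρ t ∂(lam.meas (𝒢.r x))) * c := integral_mul_const _ _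
    _ ≤ c := mul_le_of_le_one_left hc (hρ1 _)

theorem normIr_le_one (lam : HaarSystem 𝒢) {F : C_c(G, ℂ)} {ρ : G → ℝ}
    (hFρ : ∀ x, F x = ρ x) (hρ0 : ∀ x, 0 ≤ ρ x) (hρ1 : ∀ u, ∫ t, ρ t ∂(lam.meas u) ≤ 1) :
    lam.normIr F ≤ 1 := by
  refine Real.iSup_le (fun u => ?_) zero_le_one
  simpa [hFρ, abs_of_nonneg (hρ0 _)] using hρ1 u

/-- A sequence of nonnegative functions of norm at most `1` whose convolutions with any `f`
converge to `f`, dominated by multiples of a fixed element of `C_c(G)`. -/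
theorem exists_approximate_identity (lam : HaarSystem 𝒢) :
    ∃ F : ℕ → C_c(G, ℂ), (∀ n x, 0 ≤ F n x) ∧ (∀ n, lam.normIr (F n) ≤ 1) ∧
      ∀ f : C_c(G, ℂ), ∃ ψ : C_c(G, ℂ), ∀ δ > 0, ∀ᶠ n in atTop, ∀ x,
        ‖(lam.conv (F n) f - f) x‖ ≤ δ * ‖ψ x‖ := by
  obtain ⟨W, hWo, hWu, hW⟩ := 𝒢.exists_seq_nhds_units
  let K := CompactExhaustion.choice G
  choose ρ hρc hρs hρ0 hρW hρ1 hρK using fun n =>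
    exists_normalized_bump lam (hWo n) (hWu n) ((K.isCompact n).image 𝒢.continuous_r)
  let F : ℕ → C_c(G, ℂ) := fun n => ⟨⟨fun t => (ρ n t : ℂ), by have := hρc n; fun_prop⟩,
    (hρs n).comp_left (g := fun y : ℝ => (y : ℂ)) (by simp)⟩
  have hFρ : ∀ n x, F n x = ρ n x := fun n x => rfl
  refine ⟨F, fun n x => ?_, fun n => normIr_le_one lam (hFρ n) (hρ0 n) (hρ1 n), fun f => ?_⟩
  · rw [hFρ]
    exact Complex.zero_le_real.2 (hρ0 n x)
  obtain ⟨ψ, hψ⟩ := exists_translate_sub_le 𝒢 f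
  refine ⟨ψ, fun δ hδ => ?_⟩
  obtain ⟨V, hVo, hVu, hV⟩ := hψ δ hδ
  obtain ⟨N, hN⟩ := K.exists_superset_of_isCompact f.hasCompactSupport.isCompact
  filter_upwards [hW _ (f.hasCompactSupport.isCompact.image 𝒢.continuous_r) V hVo hVu,
    eventually_ge_atTop N] with n hn hNn x
  refine norm_conv_sub_le lam (hFρ n) (hρ0 n) (hρ1 n)
    (fun hx => hρK n _ ⟨x, K.subset hNn (hN (subset_tsupport _ hx)), rfl⟩) (by positivity)
    fun t ht hxt => ?_
  -- The values `f x` and `f (t⁻¹ x)` can be nonzero only if `r t`, respectively `s t`, lies in the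
  -- image of the support of `f`; this is why `W n` must control both ends.
  by_cases htK : 𝒢.r t ∈ 𝒢.r '' tsupport f ∨ 𝒢.s t ∈ 𝒢.r '' tsupport f
  · exact hV t (hn t (hρW n t ht) htK) x hxt
  · rw [not_or] at htK
    have h1 : f x = 0 :=
      image_eq_zero_of_notMem_tsupport fun h => htK.1 ⟨x, h, hxt⟩
    have h2 : f (𝒢.mul (𝒢.inv t) x) = 0 :=
      image_eq_zero_of_notMem_tsupport fun h => htK.2 ⟨_, h, 𝒢.r_inv_mul hxt⟩
    rw [h1, h2, sub_zero, norm_zero]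
    positivity

end HaarSystem

/-- The first conjunct makes the last one non-vacuous: each `L n` exists and is determined by `F n`.
-/
theorem proposition11 {G X : Type*} [TopologicalSpace G] [TopologicalSpace X] [T2Space G]
    [LocallyCompactSpace G] [SecondCountableTopology G] [MeasurableSpace G] [BorelSpace G]
    (𝒢 : TopGroupoid G X) (lam : HaarSystem 𝒢) :
    (∀ F : C_c(G, ℂ), ∃! T : lam.E2 →L[ℂ] lam.E2, lam.IsLeftConv F T) ∧
    ∃ F : ℕ → C_c(G, ℂ),
      (∀ n x, 0 ≤ F n x) ∧
      (∃ M : ℝ, ∀ n, lam.normIr (F n) ≤ M) ∧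
      (∀ f : C_c(G, ℂ), Tendsto (fun n => lam.normIr (lam.conv (F n) f - f)) atTop (𝓝 0)) ∧
      ∀ L : ℕ → (lam.E2 →L[ℂ] lam.E2), (∀ n, lam.IsLeftConv (F n) (L n)) →
        ∀ ξ : lam.E2, Tendsto (fun n => L n ξ) atTop (𝓝 ξ) := by
  refine ⟨lam.existsUnique_isLeftConv, ?_⟩
  obtain ⟨F, hF0, hF1, hF⟩ := lam.exists_approximate_identity
  have htend : ∀ {a : ℕ → ℝ} {b : ℝ}, (∀ n, 0 ≤ a n) → 0 ≤ b →
      (∀ δ > 0, ∀ᶠ n in atTop, a n ≤ δ * b) → Tendsto a atTop (𝓝 0) := by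
    intro a b ha hb h
    rw [Metric.tendsto_nhds]
    intro ε hε
    -- `b` may be zero, hence the `+ 1`.
    filter_upwards [h (ε / (b + 1)) (by positivity)] with n hn
    rw [Real.dist_0_eq_abs, abs_of_nonneg (ha n)]
    refine hn.trans_lt ?_
    rw [div_mul_eq_mul_div, div_lt_iff₀ (by positivity)]
    nlinarith
  refine ⟨F, hF0, ⟨1, hF1⟩, fun f => ?_, fun L hL ξ => ?_⟩
  · obtain ⟨ψ, hψ⟩ := hF f
    refine htend (fun n => lam.normIr_nonneg _) (lam.normIr_nonneg ψ) fun δ hδ => ?_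
    filter_upwards [hψ δ hδ] with n hn
    exact lam.normIr_le_of_le hδ.le hn
  · have hconv : ∀ f : C_c(G, ℂ),
        Tendsto (fun n => ‖lam.toE2 (lam.conv (F n) f - f)‖) atTop (𝓝 0) := fun f => by
      obtain ⟨ψ, hψ⟩ := hF f
      refine htend (fun n => norm_nonneg _) (norm_nonneg (lam.toE2 ψ)) fun δ hδ => ?_
      filter_upwards [hψ δ hδ] with n hn
      exact lam.norm_toE2_le_of_le hδ.le hn
    rw [Metric.tendsto_nhds]
    intro ε hε
    obtain ⟨f, hf⟩ := lam.denseRange_toE2.exists_dist_lt ξ (show 0 < ε / 3 by positivity)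
    filter_upwards [(hconv f).eventually (gt_mem_nhds (show 0 < ε / 3 by positivity))] with n hn
    rw [dist_eq_norm] at hf ⊢
    have hLn : ‖L n (ξ - lam.toE2 f)‖ ≤ ‖ξ - lam.toE2 f‖ :=
      ((hL n).norm_apply_le _).trans (mul_le_of_le_one_left (norm_nonneg _) (hF1 n))
    -- The `ε / 3` argument: the outer terms are small by density and contractivity, the middle one
    -- by convergence on `C_c(G)`.
    have hsplit : L n ξ - ξ = L n (ξ - lam.toE2 f) + lam.toE2 (lam.conv (F n) f - f) -
        (ξ - lam.toE2 f) := by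
      have : lam.toE2 (lam.conv (F n) f - f) = lam.toE2 (lam.conv (F n) f) - lam.toE2 f :=
        map_sub lam.toE2Linear _ _
      rw [map_sub, hL n f, this]
      abel
    rw [hsplit]
    have h1 := norm_sub_le (L n (ξ - lam.toE2 f) + lam.toE2 (lam.conv (F n) f - f))
      (ξ - lam.toE2 f)
    have h2 := norm_add_le (L n (ξ - lam.toE2 f)) (lam.toE2 (lam.conv (F n) f - f))
    linarith
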